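/- Let $V$ be a real vector space of finite dimension $n$ and let $\mathcal H$ be a finite set of linear hyperplanes (subspaces of codimension one) of $V$ with $\bigcap_{H\in\mathcal H}H=0$. A flat of $\mathcal H$ is an intersection $\bigcap_{H\in J}H$ with $J\subset\mathcal H$ (for $J=\emptyset$ this is $V$). The dual arrangement $\mathcal H^\vee$ is the finite set of hyperplanes $l^\perp=\{f\in V^*: f|_l=0\}$ of $V^*$, where $l$ runs over the one-dimensional flats of $\mathcal H$. Its faces are the classes of points of $V^*$ that have the same position (on the hyperplane, or strictly on one of its two sides) with respect to every hyperplane of $\mathcal H^\vee$. The dimension of a face is the dimension of its linear span, a chamber is a face of dimension $n$, and for faces $A^\vee,B^\vee$ we write $A^\vee\le B^\vee$ if $A^\vee\subset\overline{B^\vee}$. For a face $A^\vee$ define the big dual cone and the small dual cone by $$U(A^\vee)=\{x\in V: f(x)\ge 0\ \text{ for all } f\in A^\vee\},\qquad V(A^\vee)=\bigcap_{\substack{B^\vee\ge A^\vee\\ B^\vee\text{ a chamber}}}U(B^\vee).$$ For $Z\subset V$ let $\mathbf 1_Z:V\to\mathbb R$ be the characteristic function of $Z$. Then for every face $A^\vee$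 of $\mathcal H^\vee$ one has the following identities of functions on $V$, the sums being over the (finitely many) faces $B^\vee$ of $\mathcal H^\vee$ with $B^\vee\ge A^\vee$: $$\text{(a)}\qquad \mathbf 1_{U(A^\vee)}=\sum_{B^\vee\ge A^\vee}(-1)^{n-\dim(B^\vee)}\,\mathbf 1_{V(B^\vee)},$$ $$\text{(b)}\qquad \mathbf 1_{V(A^\vee)}=\sum_{B^\vee\ge A^\vee}(-1)^{n-\dim(B^\vee)}\,\mathbf 1_{U(B^\vee)}.$$ -/

import Mathlib

/-- A finite central arrangement of hyperplanes: a finite set of linear hyperplanes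
(linear subspaces of codimension one) in a real vector space. -/
structure HyperplaneArrangement (E : Type*) [AddCommGroup E] [Module ℝ E] where
  /-- the finite set of hyperplanes -/
  hyperplanes : Finset (Submodule ℝ E)
  codim_eq_one : ∀ H ∈ hyperplanes, Module.finrank ℝ (E ⧸ H) = 1

namespace HyperplaneArrangement

open Module

section Faces

variable {E : Type*} [AddCommGroup E] [Module ℝ E]

/-- The intersection of all the hyperplanes is `0`. -/
def IsEssential (𝓗 : HyperplaneArrangement E) : Prop :=
  ⨅ H ∈ 𝓗.hyperplanes, H = ⊥

/-- A flat is the intersection of some (possibly none, possibly all) of the hyperplanes. -/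
def IsFlat (𝓗 : HyperplaneArrangement E) (L : Submodule ℝ E) : Prop :=
  ∃ J : Finset (Submodule ℝ E), J ⊆ 𝓗.hyperplanes ∧ L = ⨅ H ∈ J, H

/-- `x` and `y` have the same position with respect to every hyperplane `H`: every linear
equation of `H` has the same sign (positive, zero or negative) at `x` and at `y`. -/
def SamePosition (𝓗 : HyperplaneArrangement E) (x y : E) : Prop :=
  ∀ H ∈ 𝓗.hyperplanes, ∀ φ : Dual ℝ E, LinearMap.ker φ = H →
    SignType.sign (φ x) = SignType.sign (φ y)

/-- The faces of an arrangement: the classes of points with the same position. -/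
def Face (𝓗 : HyperplaneArrangement E) : Type _ :=
  {F : Set E // ∃ x : E, F = {y | 𝓗.SamePosition x y}}

/-- The underlying set of points of a face. -/
def Face.carrier {𝓗 : HyperplaneArrangement E} (A : 𝓗.Face) : Set E := A.1

/-- The dimension of a face, that is, the dimension of its linear span. -/
noncomputable def Face.dim {𝓗 : HyperplaneArrangement E} (A : 𝓗.Face) : ℕ :=
  finrank ℝ (Submodule.span ℝ A.carrier)

/-- Chambers are the faces of full dimension. -/
def Face.IsChamber {𝓗 : HyperplaneArrangement E} (A : 𝓗.Face) : Prop :=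
  A.dim = finrank ℝ E

/-- The order on faces: `A ≤ B` when `A` is contained in the closure of `B`. -/
instance [TopologicalSpace E] (𝓗 : HyperplaneArrangement E) : LE 𝓗.Face :=
  ⟨fun A B => A.carrier ⊆ closure B.carrier⟩

theorem exists_equation (H : Submodule ℝ E) (h : finrank ℝ (E ⧸ H) = 1) :
    ∃ φ : Dual ℝ E, LinearMap.ker φ = H := by
  have : FiniteDimensional ℝ (E ⧸ H) := FiniteDimensional.of_finrank_eq_succ h
  let e : (E ⧸ H) ≃ₗ[ℝ] ℝ := LinearEquiv.ofFinrankEq _ _ (by simpa using h)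
  refine ⟨e.toLinearMap ∘ₗ H.mkQ, ?_⟩
  rw [LinearEquiv.ker_comp, Submodule.ker_mkQ]

theorem sign_eq_of_ker_eq {φ ψ : Dual ℝ E} (h : LinearMap.ker φ = LinearMap.ker ψ) {x y : E}
    (hs : SignType.sign (φ x) = SignType.sign (φ y)) :
    SignType.sign (ψ x) = SignType.sign (ψ y) := by
  obtain ⟨c, hc⟩ : ∃ c : ℝ, c • φ = ψ := by
    have := (mem_span_of_iInf_ker_le_ker (L := fun _ : Unit => φ) (K := ψ) (by simp [h]))
    simpa [Submodule.mem_span_singleton] using this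
  simp [← hc, sign_mul, hs]

/-- An arrangement has finitely many faces. -/
instance finite_face (𝓗 : HyperplaneArrangement E) : Finite 𝓗.Face := by
  choose φ hφ using fun H : 𝓗.hyperplanes => exists_equation H.1 (𝓗.codim_eq_one H.1 H.2)
  choose p hp using fun A : 𝓗.Face => A.2
  have key : ∀ x y : E, (∀ H, SignType.sign (φ H x) = SignType.sign (φ H y)) ↔
      𝓗.SamePosition x y := fun x y =>
    ⟨fun h H hH ψ hψ => sign_eq_of_ker_eq ((hφ ⟨H, hH⟩).trans hψ.symm) (h ⟨H, hH⟩),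
      fun h H => h H.1 H.2 _ (hφ H)⟩
  refine Finite.of_injective
    (fun (A : 𝓗.Face) (H : 𝓗.hyperplanes) => SignType.sign (φ H (p A))) fun A B hAB => ?_
  apply Subtype.ext
  rw [hp A, hp B]
  ext y
  have hs : ∀ H, SignType.sign (φ H (p A)) = SignType.sign (φ H (p B)) := fun H => congrFun hAB H
  change 𝓗.SamePosition (p A) y ↔ 𝓗.SamePosition (p B) y
  simp only [← key, hs]

noncomputable instance (𝓗 : HyperplaneArrangement E) : Fintype 𝓗.Face := Fintype.ofFinite _

end Faces

section Dual

variable {V : Type*} [NormedAddCommGroup V] [NormedSpace ℝ V]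

/-- The orthogonal of a subspace of `V` in the dual space of `V`. -/
def orthogonal (L : Submodule ℝ V) : Submodule ℝ (StrongDual ℝ V) where
  carrier := {f | ∀ x ∈ L, f x = 0}
  add_mem' hf hg x hx := by simp [hf x hx, hg x hx]
  zero_mem' := by simp
  smul_mem' c f hf x hx := by simp [hf x hx]

theorem finrank_quotient_orthogonal (L : Submodule ℝ V) (hL : finrank ℝ L = 1) :
    finrank ℝ (StrongDual ℝ V ⧸ orthogonal L) = 1 := by
  obtain ⟨v, hv, hspan⟩ := finrank_eq_one_iff'.mp hL
  have hv' : (v : V) ≠ 0 := by simpa using hv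
  let ev : StrongDual ℝ V →ₗ[ℝ] ℝ :=
    { toFun := fun f => f v, map_add' := fun _ _ => rfl, map_smul' := fun _ _ => rfl }
  have hker : LinearMap.ker ev = orthogonal L := by
    ext f
    refine ⟨fun hf x hx => ?_, fun hf => hf v v.2⟩
    obtain ⟨c, hc⟩ := hspan ⟨x, hx⟩
    have hx' : x = c • (v : V) := by simpa using (congrArg Subtype.val hc).symm
    have hf' : f v = 0 := hf
    simp [hx', hf']
  have hsurj : Function.Surjective ev := by
    obtain ⟨g, -, hg⟩ := exists_dual_vector ℝ (v : V) (by simpa using hv')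
    intro t
    refine ⟨(t / ‖(v : V)‖) • g, ?_⟩
    have : ‖(v : V)‖ ≠ 0 := by simpa using hv'
    simp [ev, hg, this]
  rw [← hker, (ev.quotKerEquivOfSurjective hsurj).finrank_eq, finrank_self]

open Classical in
/-- The dual arrangement, in the dual space: its hyperplanes are the orthogonals of the
one-dimensional flats. -/
noncomputable def dual (𝓗 : HyperplaneArrangement V) :
    HyperplaneArrangement (StrongDual ℝ V) where
  hyperplanes :=
    ((𝓗.hyperplanes.powerset.image fun J => (⨅ H ∈ J, H : Submodule ℝ V)).filter
      fun l : Submodule ℝ V => finrank ℝ l = 1).image orthogonal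
  codim_eq_one K hK := by
    obtain ⟨l, hl, rfl⟩ := Finset.mem_image.mp hK
    exact finrank_quotient_orthogonal l (Finset.mem_filter.mp hl).2

theorem mem_dual_hyperplanes (𝓗 : HyperplaneArrangement V)
    (K : Submodule ℝ (StrongDual ℝ V)) :
    K ∈ 𝓗.dual.hyperplanes ↔
      ∃ l : Submodule ℝ V, 𝓗.IsFlat l ∧ finrank ℝ l = 1 ∧ K = orthogonal l := by
  simp only [dual, IsFlat, Finset.mem_image, Finset.mem_filter, Finset.mem_powerset]
  constructor
  · rintro ⟨l, ⟨⟨J, hJ, rfl⟩, hl⟩, rfl⟩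
    exact ⟨_, ⟨J, hJ, rfl⟩, hl, rfl⟩
  · rintro ⟨l, ⟨J, hJ, rfl⟩, hl, rfl⟩
    exact ⟨_, ⟨⟨J, hJ, rfl⟩, hl⟩, rfl⟩

/-- The big dual cone of a face `A` of the dual arrangement. -/
def bigCone {𝓗 : HyperplaneArrangement V} (A : 𝓗.dual.Face) : Set V :=
  {x | ∀ f ∈ A.carrier, 0 ≤ f x}

/-- The small dual cone of a face `A` of the dual arrangement: the intersection of the big
dual cones of all chambers `B ≥ A`. -/
def smallCone {𝓗 : HyperplaneArrangement V} (A : 𝓗.dual.Face) : Set V :=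
  ⋂ (B : 𝓗.dual.Face) (_ : A ≤ B) (_ : B.IsChamber), bigCone B

end Dual

end HyperplaneArrangement

open Module Filter Topology

/-! ### Sign cells and convex sets open in a subspace. -/

section SignVectors

variable {E : Type*} [AddCommGroup E] [Module ℝ E]

/-! Fix `x` in `V` and let `ξ` be evaluation at `x`, a functional on the dual space. The faces above
`A` fill an open convex set, the star of `A`. Such a face fails `ξ ≥ 0` exactly when it meets the
part of the star where `ξ < 0`, which is again open and convex. By `eulerSum_of_convex`, the cells
meeting a nonempty open convex set, each counted with the parity of its dimension, sum to `(-1)^n`.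
Hence the signed count of the faces above `A` with `ξ ≥ 0` is `(-1)^n` if `ξ ≥ 0` on the whole star
and `0` otherwise (`sum_nonneg_faces`). A generic perturbation shows that `ξ ≥ 0` on the star means
`ξ ≥ 0` on every chamber above `A` (`forall_isChamber_iff`), that is, `x` lies in the small cone.
This is (b).

Identity (a) is the Möbius inverse of (b). The inversion needs the Euler relation for an interval of
faces from `A` to `C` (`sum_interval`). In the span of `C`, this interval consists of the faces in
the star of `A` that avoid finitely many open half-spaces with a common point in the star;
inclusion-exclusion over these (`eulerSum_inter_sign_ne`) gives zero unless `A = C`. -/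

theorem eventually_sign_add_smul (ψ : Dual ℝ E) (p w : E) :
    ∀ᶠ ε in 𝓝[>] (0 : ℝ), SignType.sign (ψ (p + ε • w)) =
      if ψ p = 0 then SignType.sign (ψ w) else SignType.sign (ψ p) := by
  have hlim : Tendsto (fun ε : ℝ => ψ (p + ε • w)) (𝓝[>] 0) (𝓝 (ψ p)) := by
    have : Continuous fun ε : ℝ => ψ p + ε * ψ w := by fun_prop
    simpa using (this.tendsto 0).mono_left nhdsWithin_le_nhds
  rcases lt_trichotomy (ψ p) 0 with h | h | h
  · filter_upwards [hlim.eventually_lt_const h] with ε hε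
    rw [if_neg h.ne, sign_neg hε, sign_neg h]
  · filter_upwards [self_mem_nhdsWithin] with ε hε
    have hε' : 0 < ε := hε
    simp [h, sign_mul, sign_pos hε']
  · filter_upwards [hlim.eventually_const_lt h] with ε hε
    rw [if_neg h.ne', sign_pos hε, sign_pos h]

/-- `S` contains a short segment from each of its points in every direction of `W`. -/
def IsRadiallyOpen (W : Submodule ℝ E) (S : Set E) : Prop :=
  ∀ p ∈ S, ∀ w ∈ W, ∀ᶠ ε in 𝓝[>] (0 : ℝ), p + ε • w ∈ S

theorem IsRadiallyOpen.inter {W : Submodule ℝ E} {S T : Set E} (hS : IsRadiallyOpen W S)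
    (hT : IsRadiallyOpen W T) : IsRadiallyOpen W (S ∩ T) := fun p hp w hw =>
  (hS p hp.1 w hw).and (hT p hp.2 w hw)

theorem IsRadiallyOpen.mono {W W' : Submodule ℝ E} {S : Set E} (hS : IsRadiallyOpen W S)
    (h : W' ≤ W) : IsRadiallyOpen W' S := fun p hp w hw => hS p hp w (h hw)

theorem isRadiallyOpen_submodule (W : Submodule ℝ E) : IsRadiallyOpen W (W : Set E) :=
  fun _ hp _ hw => .of_forall fun ε => W.add_mem hp (W.smul_mem ε hw)

theorem isRadiallyOpen_sign_eq (W : Submodule ℝ E) (ψ : Dual ℝ E) {s : SignType} (hs : s ≠ 0) :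
    IsRadiallyOpen W {y | SignType.sign (ψ y) = s} := by
  intro p hp w _
  filter_upwards [eventually_sign_add_smul ψ p w] with ε hε
  have hp' : SignType.sign (ψ p) = s := hp
  have : ψ p ≠ 0 := by
    rw [← sign_ne_zero, hp']; exact hs
  exact hε.trans (by rw [if_neg this, hp'])

theorem isRadiallyOpen_sign_eq_zero {W : Submodule ℝ E} {ψ : Dual ℝ E}
    (hW : W ≤ LinearMap.ker ψ) : IsRadiallyOpen W {y | SignType.sign (ψ y) = 0} := by
  intro p hp w hw
  have hp' : ψ p = 0 := by simpa using hp
  have hw' : ψ w = 0 := hW hw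
  exact .of_forall fun ε => by simp [hp', hw']

theorem convex_sign_eq (ψ : Dual ℝ E) (s : SignType) :
    Convex ℝ {y | SignType.sign (ψ y) = s} := by
  cases s
  · have : {y | SignType.sign (ψ y) = SignType.zero} = {y | ψ y = 0} := by
      ext; exact sign_eq_zero_iff
    rw [this]; exact convex_hyperplane ψ.isLinear 0
  · have : {y | SignType.sign (ψ y) = SignType.neg} = {y | ψ y < 0} := by
      ext; exact sign_eq_neg_one_iff
    rw [this]; exact convex_halfSpace_lt ψ.isLinear 0
  · have : {y | SignType.sign (ψ y) = SignType.pos} = {y | 0 < ψ y} := by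
      ext; exact sign_eq_one_iff
    rw [this]; exact convex_halfSpace_gt ψ.isLinear 0

theorem finrank_inf_ker_add_one [FiniteDimensional ℝ E] {W : Submodule ℝ E} {ψ : Dual ℝ E}
    (h : ¬ W ≤ LinearMap.ker ψ) :
    finrank ℝ (W ⊓ LinearMap.ker ψ : Submodule ℝ E) + 1 = finrank ℝ W := by
  have hne : ψ.domRestrict W ≠ 0 := by
    rintro h0
    exact h fun w hw => by simpa using LinearMap.congr_fun h0 ⟨w, hw⟩
  rw [← Dual.finrank_ker_add_one_of_ne_zero hne, LinearMap.ker_domRestrict,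
    ← Submodule.finrank_map_subtype_eq W, Submodule.map_comap_subtype]

/-- The points at which the functionals `φ` have the signs prescribed by `σ`. -/
def signCell {ι : Type*} (φ : ι → Dual ℝ E) (σ : ι → SignType) : Set E :=
  {y | ∀ i, SignType.sign (φ i y) = σ i}

/-- The common kernel of the functionals to which `σ` assigns the sign zero. -/
def signSpan {ι : Type*} (φ : ι → Dual ℝ E) (σ : ι → SignType) : Submodule ℝ E :=
  ⨅ (i) (_ : σ i = 0), LinearMap.ker (φ i)

theorem mem_signSpan {ι : Type*} {φ : ι → Dual ℝ E} {σ : ι → SignType} {y : E} :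
    y ∈ signSpan φ σ ↔ ∀ i, σ i = 0 → φ i y = 0 := by
  simp [signSpan, Submodule.mem_iInf]

theorem signCell_subset_signSpan {ι : Type*} (φ : ι → Dual ℝ E) (σ : ι → SignType) :
    signCell φ σ ⊆ signSpan φ σ := fun y hy =>
  mem_signSpan.2 fun i hi => by simpa [hi] using hy i

theorem isRadiallyOpen_signCell {ι : Type*} [Finite ι] (φ : ι → Dual ℝ E) (σ : ι → SignType) :
    IsRadiallyOpen (signSpan φ σ) (signCell φ σ) := by
  intro p hp w hw
  refine (eventually_all.2 fun i => ?_ :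
    ∀ᶠ ε in 𝓝[>] (0 : ℝ), ∀ i, SignType.sign (φ i (p + ε • w)) = σ i)
  by_cases hi : σ i = 0
  · have h1 : φ i p = 0 := by simpa [hi] using hp i
    have h2 := mem_signSpan.1 hw i hi
    exact .of_forall fun ε => by simp [h1, h2, hi]
  · exact isRadiallyOpen_sign_eq (signSpan φ σ) (φ i) hi p (hp i) w hw

/-- Every direction of `W` is a multiple of a difference of two points of `S`. Applied to sign
cells, this turns the dimension of a face into the rank of a common kernel. -/
theorem IsRadiallyOpen.span_eq {W : Submodule ℝ E} {S : Set E} (hS : IsRadiallyOpen W S)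
    (hW : S ⊆ W) (hne : S.Nonempty) : Submodule.span ℝ S = W := by
  refine le_antisymm (Submodule.span_le.2 hW) fun w hw => ?_
  obtain ⟨p, hp⟩ := hne
  obtain ⟨ε, hε, hpos⟩ := ((hS p hp w hw).and self_mem_nhdsWithin).exists
  have hpos' : (0 : ℝ) < ε := hpos
  have : w = ε⁻¹ • ((p + ε • w) - p) := by
    rw [add_sub_cancel_left, inv_smul_smul₀ hpos'.ne']
  rw [this]
  exact Submodule.smul_mem _ _
    (Submodule.sub_mem _ (Submodule.subset_span hε) (Submodule.subset_span hp))

theorem span_signCell {ι : Type*} [Finite ι] {φ : ι → Dual ℝ E} {σ : ι → SignType}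
    (h : (signCell φ σ).Nonempty) : Submodule.span ℝ (signCell φ σ) = signSpan φ σ :=
  (isRadiallyOpen_signCell φ σ).span_eq (signCell_subset_signSpan φ σ) h

end SignVectors

/-! ### Euler characteristics of convex sets cut by hyperplanes. -/

section EulerSum

variable {E : Type*} [AddCommGroup E] [Module ℝ E]

open Classical in
/-- The alternating sum, over the sign cells of `φ` that meet `S`, of the parities of the
dimensions of the traces of these cells on `W`. -/
noncomputable def eulerSum {m : ℕ} (φ : Fin m → Dual ℝ E) (W : Submodule ℝ E) (S : Set E) : ℝ :=
  ∑ σ : Fin m → SignType, if (signCell φ σ ∩ S).Nonempty then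
    (-1) ^ finrank ℝ (W ⊓ signSpan φ σ : Submodule ℝ E) else 0

@[simp]
theorem eulerSum_empty {m : ℕ} (φ : Fin m → Dual ℝ E) (W : Submodule ℝ E) :
    eulerSum φ W ∅ = 0 := by
  simp [eulerSum]

theorem eulerSum_sign_eq_add {m : ℕ} (φ : Fin m → Dual ℝ E) (W : Submodule ℝ E) (S : Set E)
    (i : Fin m) (s : SignType) :
    eulerSum φ W (S ∩ {y | SignType.sign (φ i y) = s}) +
      eulerSum φ W (S ∩ {y | SignType.sign (φ i y) ≠ s}) = eulerSum φ W S := by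
  classical
  simp only [eulerSum]
  rw [← Finset.sum_add_distrib]
  refine Finset.sum_congr rfl fun σ _ => ?_
  by_cases h : σ i = s
  · have h1 : signCell φ σ ∩ (S ∩ {y | SignType.sign (φ i y) = s}) = signCell φ σ ∩ S := by
      ext y
      exact ⟨fun hy => ⟨hy.1, hy.2.1⟩, fun hy => ⟨hy.1, hy.2, (hy.1 i).trans h⟩⟩
    have h2 : signCell φ σ ∩ (S ∩ {y | SignType.sign (φ i y) ≠ s}) = ∅ :=
      Set.eq_empty_of_forall_notMem fun y hy => hy.2.2 ((hy.1 i).trans h)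
    simp [h1, h2]
  · have h1 : signCell φ σ ∩ (S ∩ {y | SignType.sign (φ i y) ≠ s}) = signCell φ σ ∩ S := by
      ext y
      exact ⟨fun hy => ⟨hy.1, hy.2.1⟩,
        fun hy => ⟨hy.1, hy.2, fun hs => h ((hy.1 i).symm.trans hs)⟩⟩
    have h2 : signCell φ σ ∩ (S ∩ {y | SignType.sign (φ i y) = s}) = ∅ :=
      Set.eq_empty_of_forall_notMem fun y hy => h ((hy.1 i).symm.trans hy.2.2)
    simp [h1, h2]

theorem sum_signType {M : Type*} [AddCommMonoid M] (f : SignType → M) :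
    ∑ s, f s = f 0 + (f (-1) + f 1) := by
  have : (Finset.univ : Finset SignType) = {0, -1, 1} := by decide
  rw [this, Finset.sum_insert (by decide), Finset.sum_insert (by decide), Finset.sum_singleton]

/-- Cutting along one hyperplane drives the induction on the number of functionals. On the zero
piece the equation is absorbed into `W`, which is why the ambient subspace is a parameter of
`eulerSum`. -/
theorem eulerSum_succ {m : ℕ} (φ : Fin (m + 1) → Dual ℝ E) (W : Submodule ℝ E) (S : Set E) :
    eulerSum φ W S = ∑ s, eulerSum (Fin.tail φ) (if s = 0 then W ⊓ LinearMap.ker (φ 0) else W)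
      (S ∩ {y | SignType.sign (φ 0 y) = s}) := by
  classical
  simp only [eulerSum]
  rw [← (Fin.consEquiv fun _ => SignType).sum_comp, Fintype.sum_prod_type]
  refine Finset.sum_congr rfl fun s _ => Finset.sum_congr rfl fun τ _ => ?_
  have hcell : signCell φ (Fin.cons s τ) ∩ S =
      signCell (Fin.tail φ) τ ∩ (S ∩ {y | SignType.sign (φ 0 y) = s}) := by
    ext y
    simp only [signCell, Set.mem_inter_iff, Set.mem_ofPred_eq, Fin.forall_fin_succ, Fin.cons_zero,
      Fin.cons_succ, Fin.tail]
    tauto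
  have hspan : W ⊓ signSpan φ (Fin.cons s τ) =
      (if s = 0 then W ⊓ LinearMap.ker (φ 0) else W) ⊓ signSpan (Fin.tail φ) τ := by
    ext y
    split_ifs with hs <;>
    simp [Submodule.mem_inf, mem_signSpan, Fin.forall_fin_succ, Fin.tail, hs, and_assoc]
  exact if_congr (iff_of_eq (congrArg Set.Nonempty hcell))
    (congrArg (fun U : Submodule ℝ E => (-1 : ℝ) ^ finrank ℝ U) hspan) rfl

theorem exists_eq_zero_of_convex {S : Set E} (hS : Convex ℝ S) (ψ : Dual ℝ E) {p q : E}
    (hp : p ∈ S) (hq : q ∈ S) (hpn : ψ p < 0) (hqp : 0 < ψ q) : ∃ r ∈ S, ψ r = 0 := by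
  have hd : 0 < ψ q - ψ p := by linarith
  refine ⟨(ψ q / (ψ q - ψ p)) • p + (-ψ p / (ψ q - ψ p)) • q,
    hS hp hq (by positivity) (div_nonneg (by linarith) hd.le) ?_, ?_⟩
  · field_simp; ring
  · simp only [map_add, map_smul, smul_eq_mul]; field_simp; ring

/-- The Euler characteristic with compact supports of a nonempty relatively open convex set. -/
theorem eulerSum_of_convex [FiniteDimensional ℝ E] {m : ℕ} (φ : Fin m → Dual ℝ E)
    {W : Submodule ℝ E} {S : Set E} (hSW : S ⊆ W) (hc : Convex ℝ S) (ho : IsRadiallyOpen W S)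
    (hne : S.Nonempty) : eulerSum φ W S = (-1) ^ finrank ℝ W := by
  induction m generalizing W S with
  | zero =>
    have h1 : ∀ σ, W ⊓ signSpan φ σ = W := fun σ =>
      inf_eq_left.2 fun y _ => mem_signSpan.2 fun i => i.elim0
    obtain ⟨y, hy⟩ := hne
    rw [eulerSum, Fintype.sum_unique]
    exact (if_pos ⟨y, fun i => i.elim0, hy⟩).trans
      (congrArg (fun U : Submodule ℝ E => (-1 : ℝ) ^ finrank ℝ U) (h1 _))
  | succ m ih =>
    set ψ := φ 0
    have hcs := fun s => hc.inter (convex_sign_eq ψ s)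
    rw [eulerSum_succ, sum_signType, if_pos rfl, if_neg (by decide), if_neg (by decide)]
    by_cases hW : W ≤ LinearMap.ker ψ
    · have h0 : S ∩ {y | SignType.sign (ψ y) = 0} = S :=
        Set.inter_eq_left.2 fun y hy => sign_eq_zero_iff.2 (hW (hSW hy))
      have hs : ∀ s : SignType, s ≠ 0 → S ∩ {y | SignType.sign (ψ y) = s} = ∅ := fun s hs =>
        Set.eq_empty_of_forall_notMem fun y hy =>
          hs (hy.2.symm.trans (sign_eq_zero_iff.2 (hW (hSW hy.1))))
      rw [h0, hs _ (by decide), hs _ (by decide), inf_eq_left.2 hW, ih _ hSW hc ho hne]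
      simp
    · have hstrict : ∀ s : SignType, s ≠ 0 → (S ∩ {y | SignType.sign (ψ y) = s}).Nonempty →
          eulerSum (Fin.tail φ) W (S ∩ {y | SignType.sign (ψ y) = s}) = (-1) ^ finrank ℝ W :=
        fun s hs h => ih _ (Set.inter_subset_left.trans hSW) (hcs s)
          (ho.inter (isRadiallyOpen_sign_eq W ψ hs)) h
      by_cases h0 : (S ∩ {y | SignType.sign (ψ y) = 0}).Nonempty
      · have hz := ih (Fin.tail φ) (W := W ⊓ LinearMap.ker ψ)
          (fun y hy => ⟨hSW hy.1, sign_eq_zero_iff.1 hy.2⟩) (hcs 0)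
          ((ho.mono inf_le_left).inter (isRadiallyOpen_sign_eq_zero inf_le_right)) h0
        obtain ⟨p, hp, hp0⟩ := h0
        obtain ⟨w, hw, hw0⟩ := SetLike.not_le_iff_exists.1 hW
        -- From the zero `p` of `ψ` in `S`, a short step along `v` takes the sign of `ψ v`; with `w`
        -- and `-w` both strict sides of the hyperplane are reached.
        have hex : ∀ v ∈ W, (S ∩ {y | SignType.sign (ψ y) = SignType.sign (ψ v)}).Nonempty := by
          intro v hv
          obtain ⟨ε, h1, h2⟩ := ((ho p hp v hv).and (eventually_sign_add_smul ψ p v)).exists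
          rw [if_pos (sign_eq_zero_iff.1 hp0)] at h2
          exact ⟨_, h1, h2⟩
        have hw1 := hex w hw
        have hw2 := hex (-w) (W.neg_mem hw)
        rw [map_neg, Left.sign_neg] at hw2
        have hboth : (S ∩ {y | SignType.sign (ψ y) = -1}).Nonempty ∧
            (S ∩ {y | SignType.sign (ψ y) = 1}).Nonempty := by
          rcases lt_or_gt_of_ne (show ψ w ≠ 0 from hw0) with h | h
          · rw [sign_neg h] at hw1 hw2; exact ⟨hw1, by simpa using hw2⟩
          · rw [sign_pos h] at hw1 hw2; exact ⟨hw2, hw1⟩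
        -- With `d = dim W`, the three pieces give `(-1)^(d-1) + (-1)^d + (-1)^d = (-1)^d`.
        rw [hz, hstrict _ (by decide) hboth.1, hstrict _ (by decide) hboth.2,
          ← finrank_inf_ker_add_one hW]
        ring
      -- A convex set missing the hyperplane lies strictly on one side, so a single piece survives.
      · have h0' := Set.not_nonempty_iff_eq_empty.1 h0
        have hnot : ∀ y ∈ S, ψ y ≠ 0 := fun y hy hy0 => h0 ⟨y, hy, sign_eq_zero_iff.2 hy0⟩
        rw [h0', eulerSum_empty]
        obtain ⟨p, hp⟩ := hne
        rcases lt_or_gt_of_ne (hnot p hp) with h | h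
        · have : S ∩ {y | SignType.sign (ψ y) = 1} = ∅ :=
            Set.eq_empty_of_forall_notMem fun q hq => by
              obtain ⟨r, hr, hr0⟩ :=
                exists_eq_zero_of_convex hc ψ hp hq.1 h (sign_eq_one_iff.1 hq.2)
              exact hnot r hr hr0
          rw [this, hstrict (-1) (by decide) ⟨p, hp, sign_neg h⟩]
          simp
        · have : S ∩ {y | SignType.sign (ψ y) = -1} = ∅ :=
            Set.eq_empty_of_forall_notMem fun q hq => by
              obtain ⟨r, hr, hr0⟩ :=
                exists_eq_zero_of_convex hc ψ hq.1 hp (sign_eq_neg_one_iff.1 hq.2) h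
              exact hnot r hr hr0
          rw [this, hstrict 1 (by decide) ⟨p, hp, sign_pos h⟩]
          simp

/-- Inclusion-exclusion over the removed open half-spaces: thanks to the common point, every
intersection with `S` is nonempty and contributes the same `(-1)^(dim W)`, so the alternating sum
cancels once there is at least one half-space. -/
theorem eulerSum_inter_sign_ne [FiniteDimensional ℝ E] {m : ℕ} (φ : Fin m → Dual ℝ E)
    {W : Submodule ℝ E} (s : Fin m → SignType) (J : Finset (Fin m)) (hs : ∀ i ∈ J, s i ≠ 0)
    {S : Set E} (hSW : S ⊆ W) (hc : Convex ℝ S) (ho : IsRadiallyOpen W S)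
    (hne : (S ∩ {y | ∀ i ∈ J, SignType.sign (φ i y) = s i}).Nonempty) :
    eulerSum φ W (S ∩ {y | ∀ i ∈ J, SignType.sign (φ i y) ≠ s i}) =
      if J = ∅ then (-1) ^ finrank ℝ W else 0 := by
  classical
  induction J using Finset.induction_on generalizing S with
  | empty =>
    simp only [Finset.notMem_empty, false_imp_iff, implies_true, Set.ofPred_true,
      Set.inter_univ, if_true] at hne ⊢
    exact eulerSum_of_convex φ hSW hc ho hne
  | insert i J _ ih =>
    have hs' : ∀ j ∈ J, s j ≠ 0 := fun j hj => hs j (Finset.mem_insert_of_mem hj)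
    obtain ⟨p, hp, hpJ⟩ := hne
    have hpi : SignType.sign (φ i p) = s i := hpJ i (Finset.mem_insert_self i J)
    have hpJ' : ∀ j ∈ J, SignType.sign (φ j p) = s j := fun j hj =>
      hpJ j (Finset.mem_insert_of_mem hj)
    have h1 := ih hs' hSW hc ho ⟨p, hp, hpJ'⟩
    have h2 := ih hs' (S := S ∩ {y | SignType.sign (φ i y) = s i})
      (Set.inter_subset_left.trans hSW) (hc.inter (convex_sign_eq _ _))
      (ho.inter (isRadiallyOpen_sign_eq W _ (hs i (Finset.mem_insert_self i J))))
      ⟨p, ⟨hp, hpi⟩, hpJ'⟩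
    -- Restricting `S` to the half-space of `i` does not change the value for `J`, so the
    -- complementary part has sum zero.
    have h3 := eulerSum_sign_eq_add φ W (S ∩ {y | ∀ j ∈ J, SignType.sign (φ j y) ≠ s j}) i (s i)
    rw [Set.inter_right_comm, h2, h1] at h3
    have hset : S ∩ {y | ∀ j ∈ insert i J, SignType.sign (φ j y) ≠ s j} =
        S ∩ {y | ∀ j ∈ J, SignType.sign (φ j y) ≠ s j} ∩ {y | SignType.sign (φ i y) ≠ s i} := by
      ext y
      simp only [Set.mem_inter_iff, Set.mem_ofPred_eq, Finset.forall_mem_insert]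
      tauto
    rw [hset, if_neg (Finset.insert_ne_empty i J)]
    linarith

end EulerSum


namespace HyperplaneArrangement

/-! ### Faces as realized sign vectors. -/

section Equations

variable {E : Type*} [AddCommGroup E] [Module ℝ E]

/-- One equation per hyperplane suffices, since equations with the same kernel are proportional. -/
theorem exists_equations (𝓗 : HyperplaneArrangement E) :
    ∃ (m : ℕ) (φ : Fin m → Dual ℝ E), (∀ i, φ i ≠ 0) ∧
      ∀ x y, 𝓗.SamePosition x y ↔ ∀ i, SignType.sign (φ i x) = SignType.sign (φ i y) := by
  choose φ hφ using fun H : 𝓗.hyperplanes => exists_equation H.1 (𝓗.codim_eq_one H.1 H.2)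
  let e := 𝓗.hyperplanes.equivFin
  refine ⟨_, fun i => φ (e.symm i), fun i h0 => ?_, fun x y => ⟨fun h i =>
    h _ (e.symm i).2 _ (hφ _), fun h H hH ψ hψ => ?_⟩⟩
  · have h1 := 𝓗.codim_eq_one _ (e.symm i).2
    have h2 := hφ (e.symm i)
    rw [show φ (e.symm i) = 0 from h0, LinearMap.ker_zero] at h2
    rw [← h2, finrank_zero_of_subsingleton] at h1
    exact zero_ne_one h1
  · have := h (e ⟨H, hH⟩)
    beta_reduce at this
    rw [Equiv.symm_apply_apply] at this
    exact sign_eq_of_ker_eq ((hφ ⟨H, hH⟩).trans hψ.symm) this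

/-- `φ` is a family of functionals whose signs determine the faces of `𝓗`. -/
def IsEquations (𝓗 : HyperplaneArrangement E) {m : ℕ} (φ : Fin m → Dual ℝ E) : Prop :=
  ∀ x y, 𝓗.SamePosition x y ↔ ∀ i, SignType.sign (φ i x) = SignType.sign (φ i y)

variable {𝓗 : HyperplaneArrangement E} {m : ℕ} {φ : Fin m → Dual ℝ E}

/-- The signs of the functionals `φ` on a face. -/
noncomputable def Face.signs (φ : Fin m → Dual ℝ E) (A : 𝓗.Face) : Fin m → SignType :=
  fun i => SignType.sign (φ i A.2.choose)

theorem IsEquations.carrier_eq (hφ : 𝓗.IsEquations φ) (A : 𝓗.Face) :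
    A.carrier = signCell φ (A.signs φ) := by
  change A.1 = _
  conv_lhs => rw [A.2.choose_spec]
  ext y
  change 𝓗.SamePosition _ y ↔ _
  rw [hφ]
  exact forall_congr' fun i => eq_comm

theorem Face.carrier_nonempty (A : 𝓗.Face) : A.carrier.Nonempty := by
  obtain ⟨x, hx⟩ := A.2
  exact ⟨x, hx.ge fun H _ ψ _ => rfl⟩

theorem IsEquations.signs_injective (hφ : 𝓗.IsEquations φ) :
    Function.Injective (Face.signs φ : 𝓗.Face → Fin m → SignType) := fun A B h =>
  Subtype.ext (by
    have hA := hφ.carrier_eq A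
    rw [h, ← hφ.carrier_eq B] at hA
    exact hA)

theorem IsEquations.exists_face (hφ : 𝓗.IsEquations φ) (y : E) :
    ∃ B : 𝓗.Face, y ∈ B.carrier ∧ B.signs φ = fun i => SignType.sign (φ i y) := by
  let B : 𝓗.Face := ⟨_, y, rfl⟩
  have hy : y ∈ B.carrier := fun H _ ψ _ => rfl
  refine ⟨B, hy, funext fun i => ?_⟩
  rw [hφ.carrier_eq] at hy
  exact (hy i).symm

theorem IsEquations.dim_eq (hφ : 𝓗.IsEquations φ) (A : 𝓗.Face) :
    A.dim = finrank ℝ (signSpan φ (A.signs φ)) := by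
  have h := A.carrier_nonempty
  rw [hφ.carrier_eq] at h
  rw [Face.dim, hφ.carrier_eq, span_signCell h]

/-- Unrealized sign vectors have empty cells, and `hSW` makes the trace on `W` harmless, so the
exponents become dimensions of faces. -/
theorem IsEquations.eulerSum_eq (hφ : 𝓗.IsEquations φ) (W : Submodule ℝ E) (S : Set E)
    [DecidablePred fun B : 𝓗.Face => (B.carrier ∩ S).Nonempty] (hSW : ∀ B : 𝓗.Face,
      (B.carrier ∩ S).Nonempty → signSpan φ (B.signs φ) ≤ W) :
    eulerSum φ W S = ∑ B : 𝓗.Face with (B.carrier ∩ S).Nonempty, (-1) ^ B.dim := by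
  classical
  rw [Finset.sum_filter, eulerSum]
  refine (Fintype.sum_of_injective _ hφ.signs_injective _ _ (fun σ hσ => if_neg ?_)
    fun B => ?_).symm
  · rintro ⟨y, hy, -⟩
    obtain ⟨B, -, hB⟩ := hφ.exists_face y
    exact hσ ⟨B, hB.trans (funext hy)⟩
  · rw [← hφ.carrier_eq]
    by_cases h : (B.carrier ∩ S).Nonempty
    · rw [if_pos h, if_pos h, inf_eq_right.2 (hSW B h), hφ.dim_eq]
    · rw [if_neg h, if_neg h]

end Equations

/-! ### The face order, stars and Euler relations. -/

section Order

variable {E : Type*} [NormedAddCommGroup E] [NormedSpace ℝ E]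
  {𝓗 : HyperplaneArrangement E} {m : ℕ} {φ : Fin m → Dual ℝ E}

/-- The union of the faces above `A`. -/
def Face.star (φ : Fin m → Dual ℝ E) (A : 𝓗.Face) : Set E :=
  {y | ∀ i, A.signs φ i ≠ 0 → SignType.sign (φ i y) = A.signs φ i}

theorem Face.star_eq_iInter (A : 𝓗.Face) :
    A.star φ = ⋂ (i) (_ : A.signs φ i ≠ 0), {y | SignType.sign (φ i y) = A.signs φ i} := by
  ext y; simp [Face.star]

theorem Face.convex_star (A : 𝓗.Face) : Convex ℝ (A.star φ) := by
  rw [A.star_eq_iInter]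
  exact convex_iInter₂ fun i _ => convex_sign_eq _ _

theorem Face.isRadiallyOpen_star (A : 𝓗.Face) (W : Submodule ℝ E) :
    IsRadiallyOpen W (A.star φ) := by
  intro p hp w hw
  exact eventually_all.2 fun i => eventually_imp_distrib_left.2 fun hi =>
    isRadiallyOpen_sign_eq W (φ i) hi p (hp i hi) w hw

theorem IsEquations.carrier_subset_star (hφ : 𝓗.IsEquations φ) (A : 𝓗.Face) :
    A.carrier ⊆ A.star φ := by
  rw [hφ.carrier_eq]
  exact fun y hy i _ => hy i

theorem face_le_trans {A B C : 𝓗.Face} (h₁ : A ≤ B) (h₂ : B ≤ C) : A ≤ C :=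
  h₁.trans (closure_minimal h₂ isClosed_closure)

variable [FiniteDimensional ℝ E]

theorem IsEquations.le_iff (hφ : 𝓗.IsEquations φ) {A B : 𝓗.Face} :
    A ≤ B ↔ ∀ i, A.signs φ i ≠ 0 → B.signs φ i = A.signs φ i := by
  constructor
  · intro h i hi
    obtain ⟨p, hp⟩ := A.carrier_nonempty
    have hcl := h hp
    have hB := hφ.carrier_eq B
    rw [hφ.carrier_eq] at hp
    have hcont : Continuous (φ i) := (φ i).continuous_of_finiteDimensional
    have hnear : ∀ᶠ y in 𝓝 p, SignType.sign (φ i y) = A.signs φ i := by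
      rw [← hp i] at hi ⊢
      rcases lt_or_gt_of_ne (sign_ne_zero.1 hi) with h0 | h0
      · filter_upwards [hcont.continuousAt.eventually_lt_const h0] with y hy
        rw [sign_neg hy, sign_neg h0]
      · filter_upwards [hcont.continuousAt.eventually_const_lt h0] with y hy
        rw [sign_pos hy, sign_pos h0]
    obtain ⟨y, hy, hy'⟩ := (mem_closure_iff_frequently.1 hcl).and_eventually hnear |>.exists
    rw [hB] at hy
    exact (hy i).symm.trans hy'
  · intro h p hp
    obtain ⟨q, hq⟩ := B.carrier_nonempty
    rw [hφ.carrier_eq] at hp hq ⊢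
    -- The points `p + ε • q` keep the nonzero signs of `A` and take the signs of `B` elsewhere, so
    -- they lie in `B` for small `ε`.
    have hlim : Tendsto (fun ε : ℝ => p + ε • q) (𝓝[>] 0) (𝓝 p) := by
      have : Continuous fun ε : ℝ => p + ε • q := by fun_prop
      simpa using (this.tendsto 0).mono_left nhdsWithin_le_nhds
    refine mem_closure_of_tendsto hlim (eventually_all.2 fun i => ?_)
    filter_upwards [eventually_sign_add_smul (φ i) p q] with ε hε
    rw [hε]
    split_ifs with h0
    · exact hq i
    · have : A.signs φ i ≠ 0 := by rw [← hp i]; exact sign_ne_zero.2 h0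
      rw [h i this, hp i]

theorem IsEquations.le_iff_inter_star (hφ : 𝓗.IsEquations φ) {A B : 𝓗.Face} :
    A ≤ B ↔ (B.carrier ∩ A.star φ).Nonempty := by
  rw [hφ.le_iff]
  constructor
  · intro h
    obtain ⟨q, hq⟩ := B.carrier_nonempty
    refine ⟨q, hq, fun i hi => ?_⟩
    rw [hφ.carrier_eq] at hq
    rw [hq i, h i hi]
  · rintro ⟨q, hq, hq'⟩ i hi
    rw [hφ.carrier_eq] at hq
    rw [← hq i, hq' i hi]

theorem IsEquations.carrier_subset_star_of_le (hφ : 𝓗.IsEquations φ) {A B : 𝓗.Face}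
    (h : A ≤ B) : B.carrier ⊆ A.star φ := by
  rw [hφ.carrier_eq]
  exact fun y hy i hi => (hy i).trans (hφ.le_iff.1 h i hi)

theorem Face.dim_le (A : 𝓗.Face) : A.dim ≤ finrank ℝ E := Submodule.finrank_le _

/-- A functional is nonnegative on all the chambers above `A` if and only if it is nonnegative
on the star of `A`. -/
theorem IsEquations.forall_isChamber_iff (hφ : 𝓗.IsEquations φ) (hne : ∀ i, φ i ≠ 0)
    (A : 𝓗.Face) (ξ : Dual ℝ E) :
    (∀ B : 𝓗.Face, A ≤ B → B.IsChamber → ∀ y ∈ B.carrier, 0 ≤ ξ y) ↔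
      ∀ y ∈ A.star φ, 0 ≤ ξ y := by
  refine ⟨fun h y hy => ?_, fun h B hAB _ y hy => h y (hφ.carrier_subset_star_of_le hAB hy)⟩
  -- A vector `g` off all hyperplanes: moving `y` slightly along `g` enters a chamber above `A` and
  -- keeps `ξ` negative.
  obtain ⟨g, hg⟩ := Dual.exists_forall_ne_zero_of_forall_exists φ fun i => by
    by_contra! h0
    exact hne i (LinearMap.ext h0)
  by_contra! hy0
  have h1 : ∀ᶠ ε in 𝓝[>] (0 : ℝ), ∀ i, SignType.sign (φ i (y + ε • g)) =
      if φ i y = 0 then SignType.sign (φ i g) else SignType.sign (φ i y) :=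
    eventually_all.2 fun i => eventually_sign_add_smul (φ i) y g
  obtain ⟨ε, hε, hξ, hst⟩ := (h1.and ((eventually_sign_add_smul ξ y g).and
    (A.isRadiallyOpen_star ⊤ y hy g trivial))).exists
  rw [if_neg hy0.ne, sign_neg hy0, sign_eq_neg_one_iff] at hξ
  obtain ⟨B, hB, hBs⟩ := hφ.exists_face (y + ε • g)
  have hspan : signSpan φ (B.signs φ) = ⊤ := by
    refine eq_top_iff.2 fun z _ => mem_signSpan.2 fun i hi => absurd hi ?_
    rw [hBs]
    beta_reduce
    rw [hε i]
    split_ifs with h0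
    · exact sign_ne_zero.2 (hg i)
    · exact sign_ne_zero.2 h0
  have hch : B.IsChamber := by rw [Face.IsChamber, hφ.dim_eq, hspan, finrank_top]
  exact hξ.not_ge (h B (hφ.le_iff_inter_star.2 ⟨_, hB, hst⟩) hch _ hB)

open Classical in
/-- The alternating sum over the faces above `A` on which `ξ` is nonnegative. -/
theorem IsEquations.sum_nonneg_faces (hφ : 𝓗.IsEquations φ) (A : 𝓗.Face) (ξ : Dual ℝ E) :
    ∑ B : 𝓗.Face with A ≤ B, (-1 : ℝ) ^ B.dim * (if ∀ y ∈ B.carrier, 0 ≤ ξ y then 1 else 0) =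
      (-1) ^ finrank ℝ E * (if ∀ y ∈ A.star φ, 0 ≤ ξ y then 1 else 0) := by
  set T : Set E := A.star φ ∩ {y | SignType.sign (ξ y) = -1}
  have hTB : ∀ B : 𝓗.Face, (B.carrier ∩ T).Nonempty ↔ A ≤ B ∧ ¬ ∀ y ∈ B.carrier, 0 ≤ ξ y := by
    intro B
    constructor
    · rintro ⟨y, hy, hy1, hy2⟩
      exact ⟨hφ.le_iff_inter_star.2 ⟨y, hy, hy1⟩, fun h =>
        (sign_eq_neg_one_iff.1 hy2).not_ge (h y hy)⟩
    · rintro ⟨h, h0⟩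
      push Not at h0
      obtain ⟨y, hy, hy0⟩ := h0
      exact ⟨y, hy, hφ.carrier_subset_star_of_le h hy, sign_neg hy0⟩
  have hstar := eulerSum_of_convex φ (Set.subset_univ _) A.convex_star
    (A.isRadiallyOpen_star ⊤) (A.carrier_nonempty.mono (hφ.carrier_subset_star A))
  rw [hφ.eulerSum_eq ⊤ _ fun _ _ => le_top, finrank_top] at hstar
  have hT : eulerSum φ ⊤ T = if T.Nonempty then (-1) ^ finrank ℝ E else 0 := by
    split_ifs with h
    · rw [eulerSum_of_convex φ (Set.subset_univ _) (A.convex_star.inter (convex_sign_eq ξ _))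
        ((A.isRadiallyOpen_star ⊤).inter (isRadiallyOpen_sign_eq ⊤ ξ (by decide))) h, finrank_top]
    · rw [Set.not_nonempty_iff_eq_empty.1 h, eulerSum_empty]
  rw [hφ.eulerSum_eq ⊤ _ fun _ _ => le_top] at hT
  have hTne : T.Nonempty ↔ ¬ ∀ y ∈ A.star φ, 0 ≤ ξ y := by
    push Not
    exact exists_congr fun y => and_congr_right fun _ => sign_eq_neg_one_iff
  simp only [hTB, hTne, ← hφ.le_iff_inter_star, ← Finset.filter_filter] at hT hstar
  rw [Finset.sum_filter] at hT
  have hsum : ∑ B : 𝓗.Face with A ≤ B,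
      (-1 : ℝ) ^ B.dim * (if ∀ y ∈ B.carrier, 0 ≤ ξ y then 1 else 0) =
      ∑ B : 𝓗.Face with A ≤ B, (-1 : ℝ) ^ B.dim -
        ∑ B : 𝓗.Face with A ≤ B,
          if ¬ ∀ y ∈ B.carrier, 0 ≤ ξ y then (-1 : ℝ) ^ B.dim else 0 := by
    rw [← Finset.sum_sub_distrib]
    refine Finset.sum_congr rfl fun B _ => ?_
    by_cases h : ∀ y ∈ B.carrier, 0 ≤ ξ y
    · rw [if_pos h, if_neg (not_not.2 h), mul_one, sub_zero]
    · rw [if_neg h, if_pos h, mul_zero, sub_self]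
  rw [hsum, hstar, hT]
  by_cases h : ∀ y ∈ A.star φ, 0 ≤ ξ y
  · rw [if_pos h, if_neg (not_not.2 h), mul_one, sub_zero]
  · rw [if_neg h, if_pos h, mul_zero, sub_self]

open Classical in
/-- The Euler relation for intervals of faces. -/
theorem IsEquations.sum_interval (hφ : 𝓗.IsEquations φ) {A C : 𝓗.Face} (hAC : A ≤ C) :
    ∑ B : 𝓗.Face with A ≤ B ∧ B ≤ C, (-1 : ℝ) ^ B.dim = if A = C then (-1) ^ C.dim else 0 := by
  set σ := A.signs φ
  set τ := C.signs φ
  have hστ := hφ.le_iff.1 hAC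
  set W := signSpan φ τ
  -- The hyperplanes that contain `A` but not `C`. A face above `A` inside the span of `C` is below
  -- `C` exactly when it is never on the side opposite to `C` of one of these.
  set J : Finset (Fin m) := {i | σ i = 0 ∧ τ i ≠ 0}
  have hJ : J = ∅ ↔ A = C := by
    rw [← hφ.signs_injective.eq_iff, Finset.filter_eq_empty_iff]
    constructor
    · intro h
      funext i
      by_cases hi : σ i = 0
      · have := h (Finset.mem_univ i)
        push Not at this
        exact hi.trans (this hi).symm
      · exact (hστ i hi).symm
    · intro h i _ hi
      exact hi.2 ((congrFun h i).symm.trans hi.1)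
  have hmem : ∀ B : 𝓗.Face, (B.carrier ∩ ((A.star φ ∩ W) ∩
      {y | ∀ i ∈ J, SignType.sign (φ i y) ≠ -τ i})).Nonempty ↔ A ≤ B ∧ B ≤ C := by
    intro B
    rw [hφ.le_iff (A := B), hφ.carrier_eq B]
    constructor
    · rintro ⟨y, hy, ⟨hy1, hy2⟩, hy3⟩
      refine ⟨hφ.le_iff_inter_star.2 ⟨y, by rwa [hφ.carrier_eq], hy1⟩, fun i hi => ?_⟩
      rw [← hy i] at hi ⊢
      have hτ : τ i ≠ 0 := fun h0 => hi (by rw [mem_signSpan.1 hy2 i h0, sign_zero])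
      by_cases hσ : σ i = 0
      · have h3 := hy3 i (by simp [J, hσ, hτ])
        change τ i = _
        revert hi h3 hτ
        generalize τ i = a
        generalize SignType.sign (φ i y) = b
        revert a b
        decide
      · exact (hστ i hσ).trans (hy1 i hσ).symm
    · rintro ⟨h1, h2⟩
      obtain ⟨y, hy⟩ := B.carrier_nonempty
      have hy1 := hφ.carrier_subset_star_of_le h1 hy
      rw [hφ.carrier_eq] at hy
      have h2' : ∀ i, SignType.sign (φ i y) = 0 ∨ SignType.sign (φ i y) = τ i := fun i => by
        rw [hy i]
        by_cases h : B.signs φ i = 0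
        · exact .inl h
        · exact .inr (h2 i h).symm
      refine ⟨y, hy, ⟨hy1, mem_signSpan.2 fun i hi => ?_⟩, fun i hi => ?_⟩
      · have := h2' i
        rw [hi, or_self] at this
        exact sign_eq_zero_iff.1 this
      · have hτ : τ i ≠ 0 := (Finset.mem_filter.1 hi).2.2
        have := h2' i
        revert this hτ
        generalize τ i = a
        generalize SignType.sign (φ i y) = b
        revert a b
        decide
  have key := eulerSum_inter_sign_ne φ (W := W) (fun i => -τ i) J
    (fun i hi h => (Finset.mem_filter.1 hi).2.2 (by
      revert h; generalize τ i = a; revert a; decide))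
    (S := A.star φ ∩ W) Set.inter_subset_right (A.convex_star.inter W.convex)
    ((A.isRadiallyOpen_star W).inter (isRadiallyOpen_submodule W)) (by
      -- The common point of the removed half-spaces is `a - ε • c` with `a` in `A` and `c` in `C`:
      -- leaving `A` away from `C` gives the sign `-τ i` for every `i` in `J`.
      obtain ⟨a, ha⟩ := A.carrier_nonempty
      obtain ⟨c, hc⟩ := C.carrier_nonempty
      have haS := hφ.carrier_subset_star A ha
      rw [hφ.carrier_eq] at ha hc
      have hcW := signCell_subset_signSpan φ _ hc
      have haW : a ∈ W := mem_signSpan.2 fun i hi => by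
        by_contra h0
        have h1 : σ i ≠ 0 := by
          rw [← show SignType.sign (φ i a) = σ i from ha i]; exact sign_ne_zero.2 h0
        exact h1 ((hστ i h1).symm.trans hi)
      have hsig : ∀ᶠ ε in 𝓝[>] (0 : ℝ), ∀ i, SignType.sign (φ i (a + ε • -c)) =
          if φ i a = 0 then SignType.sign (φ i (-c)) else SignType.sign (φ i a) :=
        eventually_all.2 fun i => eventually_sign_add_smul (φ i) a (-c)
      obtain ⟨ε, h1, h2, h3⟩ := (hsig.and
        (((A.isRadiallyOpen_star W) a haS (-c) (W.neg_mem hcW)).and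
        (isRadiallyOpen_submodule W a haW (-c) (W.neg_mem hcW)))).exists
      refine ⟨_, ⟨h2, h3⟩, fun i hi => ?_⟩
      have hσ : σ i = 0 := (Finset.mem_filter.1 hi).2.1
      have ha0 : φ i a = 0 := sign_eq_zero_iff.1 ((ha i).trans hσ)
      rw [h1 i, if_pos ha0, map_neg, Left.sign_neg, hc i])
  rw [hφ.eulerSum_eq W _ fun B hB => ?_] at key
  · simp only [hmem, hJ] at key
    rw [key, hφ.dim_eq C]
  · have := hφ.le_iff.1 ((hmem B).1 hB).2
    refine fun y hy => mem_signSpan.2 fun i hi => mem_signSpan.1 hy i ?_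
    by_contra h0
    exact h0 ((this i h0).symm.trans hi)

open Classical in
/-- Möbius inversion over the faces above a given face. -/
theorem sum_sum_interval (A : 𝓗.Face) (u : 𝓗.Face → ℝ) :
    ∑ B : 𝓗.Face with A ≤ B, (-1 : ℝ) ^ B.dim *
      ∑ C : 𝓗.Face with B ≤ C, (-1 : ℝ) ^ C.dim * u C = u A := by
  obtain ⟨m, φ, -, hφ : 𝓗.IsEquations φ⟩ := 𝓗.exists_equations
  have hA : A ≤ A := subset_closure
  simp only [Finset.mul_sum]
  rw [Finset.sum_comm' (t' := {C : 𝓗.Face | A ≤ C})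
    (s' := fun C => {B : 𝓗.Face | A ≤ B ∧ B ≤ C})]
  · have : ∀ C ∈ ({C : 𝓗.Face | A ≤ C} : Finset 𝓗.Face),
        ∑ B : 𝓗.Face with A ≤ B ∧ B ≤ C, (-1 : ℝ) ^ B.dim * ((-1) ^ C.dim * u C) =
          if A = C then u C else 0 := by
      intro C hC
      rw [← Finset.sum_mul, hφ.sum_interval (Finset.mem_filter.1 hC).2]
      split_ifs
      · rw [← mul_assoc, ← pow_add, Even.neg_one_pow ⟨_, rfl⟩, one_mul]
      · rw [zero_mul]
    rw [Finset.sum_congr rfl this, Finset.sum_ite_eq, if_pos (by simpa using hA)]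
  · intro B C
    simp only [Finset.mem_filter, Finset.mem_univ, true_and]
    exact ⟨fun h => ⟨h, face_le_trans h.1 h.2⟩, fun h => h.1⟩

end Order

/-! ### Application to the dual cones. -/

section DualCones

variable {V : Type*} [NormedAddCommGroup V] [NormedSpace ℝ V] [FiniteDimensional ℝ V]

theorem finrank_strongDual : finrank ℝ (StrongDual ℝ V) = finrank ℝ V :=
  (LinearMap.toContinuousLinearMap (𝕜 := ℝ) (E := V) (F' := ℝ)).finrank_eq.symm.trans
    Subspace.dual_finrank_eq

-- This is (b) at a point, with the sign `(-1)^n` factored out. It comes from `sum_nonneg_faces` for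
-- evaluation at `x`.
open Classical in
theorem indicator_smallCone_apply {𝓗 : HyperplaneArrangement V} (A : 𝓗.dual.Face) (x : V) :
    (smallCone A).indicator (1 : V → ℝ) x =
      (-1) ^ finrank ℝ V * ∑ B : 𝓗.dual.Face with A ≤ B, (-1 : ℝ) ^ B.dim *
        (bigCone B).indicator (1 : V → ℝ) x := by
  obtain ⟨m, φ, hne, hφ : 𝓗.dual.IsEquations φ⟩ := 𝓗.dual.exists_equations
  let ξ : Dual ℝ (StrongDual ℝ V) := (ContinuousLinearMap.apply ℝ ℝ x).toLinearMap
  have h := hφ.sum_nonneg_faces A ξ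
  rw [finrank_strongDual] at h
  have hbig : ∀ B : 𝓗.dual.Face, (bigCone B).indicator (1 : V → ℝ) x =
      if ∀ y ∈ B.carrier, 0 ≤ ξ y then 1 else 0 := fun B => rfl
  have hsmall : (smallCone A).indicator (1 : V → ℝ) x =
      if ∀ y ∈ A.star φ, 0 ≤ ξ y then 1 else 0 := by
    have : x ∈ smallCone A ↔ ∀ y ∈ A.star φ, 0 ≤ ξ y := by
      rw [← hφ.forall_isChamber_iff hne]
      simp only [smallCone, Set.mem_iInter]
      rfl
    simp only [Set.indicator_apply, this, Pi.one_apply]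
  simp only [hbig]
  rw [h, hsmall, ← mul_assoc, ← pow_add, Even.neg_one_pow ⟨_, rfl⟩, one_mul]

end DualCones

end HyperplaneArrangement

open Classical in
theorem corollary4p8 {V : Type*} [NormedAddCommGroup V] [NormedSpace ℝ V]
    [FiniteDimensional ℝ V] (𝓗 : HyperplaneArrangement V) (h𝓗 : 𝓗.IsEssential)
    (A : 𝓗.dual.Face) :
    ((HyperplaneArrangement.bigCone A).indicator (1 : V → ℝ) =
      ∑ B : 𝓗.dual.Face with A ≤ B, (-1 : ℝ) ^ (Module.finrank ℝ V - B.dim) •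
        (HyperplaneArrangement.smallCone B).indicator (1 : V → ℝ)) ∧
    ((HyperplaneArrangement.smallCone A).indicator (1 : V → ℝ) =
      ∑ B : 𝓗.dual.Face with A ≤ B, (-1 : ℝ) ^ (Module.finrank ℝ V - B.dim) •
        (HyperplaneArrangement.bigCone B).indicator (1 : V → ℝ)) := by
  have hfin : finrank ℝ (StrongDual ℝ V) = finrank ℝ V :=
    HyperplaneArrangement.finrank_strongDual
  have hsign : ∀ B : 𝓗.dual.Face, (-1 : ℝ) ^ (finrank ℝ V - B.dim) =
      (-1) ^ finrank ℝ V * (-1) ^ B.dim := fun B => by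
    -- The natural subtraction is not truncated, because the dimension of a face is at most `n`.
    have h : finrank ℝ V - B.dim + (B.dim + B.dim) = finrank ℝ V + B.dim := by
      have := B.dim_le
      omega
    rw [← pow_add, ← h, pow_add _ _ (B.dim + B.dim), Even.neg_one_pow (n := B.dim + B.dim) ⟨_, rfl⟩,
      mul_one]
  have hsq : (-1 : ℝ) ^ finrank ℝ V * (-1) ^ finrank ℝ V = 1 := by
    rw [← pow_add, Even.neg_one_pow ⟨_, rfl⟩]
  constructor
  · funext x
    simp only [Finset.sum_apply, Pi.smul_apply, smul_eq_mul, hsign,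
      HyperplaneArrangement.indicator_smallCone_apply _ x]
    -- Expanding each small cone by (b) leaves the double sum of the Möbius inversion; the two
    -- factors `(-1)^n` cancel.
    rw [← HyperplaneArrangement.sum_sum_interval A fun B =>
      (HyperplaneArrangement.bigCone B).indicator (1 : V → ℝ) x]
    refine Finset.sum_congr rfl fun B _ => ?_
    rw [mul_mul_mul_comm, ← mul_assoc, hsq, one_mul]
  · funext x
    simp only [Finset.sum_apply, Pi.smul_apply, smul_eq_mul, hsign, mul_assoc,
      HyperplaneArrangement.indicator_smallCone_apply A x, Finset.mul_sum]
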